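/- Let $n, N \ge 0$ be integers, let $M$ be a smooth $n$-dimensional manifold (Hausdorff, without boundary, not necessarily connected), and let $\mathbf{x} : M \to \mathbb{E}^N$ be a smooth immersion into Euclidean space that is a proper map. Let $g$ be the Riemannian metric on $M$ induced by $\mathbf{x}$, and let $h$ be the second fundamental form, so that $h(X,Y)$ is the component of $D_X Y$ normal to $M$, where $D$ is the flat connection of $\mathbb{E}^N$. Let $$\mathbf{H} = \frac1n \sum_{i=1}^n h(e_i, e_i)$$ be the mean curvature vector field, where $(e_i)$ is a local $g$-orthonormal frame (and $\mathbf{H} = 0$ if $n = 0$), and let $\Delta$ be the Laplace–Beltrami operator of $(M,g)$, acting componentwise on $\mathbb{E}^N$-valued functions. If $M$ is biharmonic, that is, if $\Delta \mathbf{H} = 0$ on $M$, then $M$ is minimal, that is, $\mathbf{H} = 0$ on $M$. -/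

import Mathlib

open scoped Manifold ContDiff InnerProductSpace

noncomputable section

namespace Submanifold

section Coordinates

variable {n : ℕ} {E : Type*} [NormedAddCommGroup E] [InnerProductSpace ℝ E]

/-- The `i`-th partial derivative `∂ᵢ u` of a map defined on (an open subset of) `ℝⁿ`. -/
def pderiv (i : Fin n) (u : EuclideanSpace ℝ (Fin n) → E) (y : EuclideanSpace ℝ (Fin n)) : E :=
  fderiv ℝ u y (EuclideanSpace.single i 1)

/-- The matrix `gᵢⱼ = ⟨∂ᵢF, ∂ⱼF⟩` of the Riemannian metric that a local parametrization `F`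
induces. -/
def inducedMetric (F : EuclideanSpace ℝ (Fin n) → E) (y : EuclideanSpace ℝ (Fin n)) :
    Matrix (Fin n) (Fin n) ℝ :=
  Matrix.of fun i j => ⟪pderiv i F y, pderiv j F y⟫_ℝ

/-- The Christoffel symbols
`Γᵏᵢⱼ = ½ ∑ₗ gᵏˡ (∂ᵢ gⱼₗ + ∂ⱼ gᵢₗ - ∂ₗ gᵢⱼ)` of the Levi-Civita connection of `g`. -/
def christoffel (g : EuclideanSpace ℝ (Fin n) → Matrix (Fin n) (Fin n) ℝ) (k i j : Fin n)
    (y : EuclideanSpace ℝ (Fin n)) : ℝ :=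
  (1 / 2 : ℝ) * ∑ l, (g y)⁻¹ k l *
    (pderiv i (fun z => g z j l) y + pderiv j (fun z => g z i l) y
      - pderiv l (fun z => g z i j) y)

/-- The Laplace-Beltrami operator of the metric `g` in coordinates, on vector-valued functions:
`Δu = ∑ᵢⱼ gⁱʲ (∂ᵢ∂ⱼ u - ∑ₖ Γᵏᵢⱼ ∂ₖ u)`. -/
def coordLaplacian (g : EuclideanSpace ℝ (Fin n) → Matrix (Fin n) (Fin n) ℝ)
    (u : EuclideanSpace ℝ (Fin n) → E) (y : EuclideanSpace ℝ (Fin n)) : E :=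
  ∑ i, ∑ j, (g y)⁻¹ i j •
    (pderiv i (pderiv j u) y - ∑ k, christoffel g k i j y • pderiv k u y)

/-- The second fundamental form of a local parametrization `F` on coordinate vector fields:
by the Gauss formula, `h(∂ᵢ, ∂ⱼ)` is the normal component of `D_{∂ᵢ} ∂ⱼ = ∂ᵢ∂ⱼ F`, that is, its
orthogonal projection to the complement of the tangent space `range (DF)`. -/
def coordSecondFundamentalForm (F : EuclideanSpace ℝ (Fin n) → E) (i j : Fin n)
    (y : EuclideanSpace ℝ (Fin n)) : E :=
  (LinearMap.range (fderiv ℝ F y).toLinearMap)ᗮ.starProjection (pderiv i (pderiv j F) y)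

/-- The mean curvature vector `H = (1/n) trace_g h = (1/n) ∑ᵢⱼ gⁱʲ h(∂ᵢ, ∂ⱼ)` of a local
parametrization. -/
def coordMeanCurvature (F : EuclideanSpace ℝ (Fin n) → E) (y : EuclideanSpace ℝ (Fin n)) : E :=
  (n : ℝ)⁻¹ • ∑ i, ∑ j, (inducedMetric F y)⁻¹ i j • coordSecondFundamentalForm F i j y

end Coordinates

section Global

variable {n : ℕ} {E : Type*} [NormedAddCommGroup E] [InnerProductSpace ℝ E]
  {M : Type*} [TopologicalSpace M] [ChartedSpace (EuclideanSpace ℝ (Fin n)) M]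

/-- The mean curvature vector field `H : M → E` of an immersion `f : M → E`, computed at `p` in the
preferred chart at `p` (the value does not depend on the chart). -/
def meanCurvature (f : M → E) (p : M) : E :=
  coordMeanCurvature (f ∘ (chartAt (EuclideanSpace ℝ (Fin n)) p).symm)
    (chartAt (EuclideanSpace ℝ (Fin n)) p p)

/-- The Laplace-Beltrami operator of the metric on `M` induced by an immersion `f : M → E`, applied
to a vector-valued function `u : M → E` and computed at `p` in the preferred chart at `p`
(the value does not depend on the chart). -/
def laplaceBeltrami (f u : M → E) (p : M) : E :=
  coordLaplacian (inducedMetric (f ∘ (chartAt (EuclideanSpace ℝ (Fin n)) p).symm))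
    (u ∘ (chartAt (EuclideanSpace ℝ (Fin n)) p).symm)
    (chartAt (EuclideanSpace ℝ (Fin n)) p p)

/-- A smooth immersion: a smooth map whose differential is injective at every point. -/
def IsSmoothImmersion (f : M → E) : Prop :=
  ContMDiff (𝓡 n) 𝓘(ℝ, E) ∞ f ∧ ∀ p : M, Function.Injective (mfderiv (𝓡 n) 𝓘(ℝ, E) f p)

/-- The immersed submanifold is biharmonic: `ΔH = 0`. -/
def IsBiharmonic (f : M → E) : Prop :=
  ∀ p : M, laplaceBeltrami (n := n) f (meanCurvature (n := n) f) p = 0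

/-- The immersed submanifold is minimal: `H = 0`. -/
def IsMinimal (f : M → E) : Prop :=
  ∀ p : M, meanCurvature (n := n) f p = 0

end Global

end Submanifold

end

open scoped Manifold ContDiff InnerProductSpace

noncomputable section

namespace Submanifold

open Filter Topology

/-! ### Local geometry of a parametrization: orthonormal frames, the Gauss formula, smoothness and
chart independence of `H`. -/

section Coordinates

variable {n : ℕ} {E : Type*} [NormedAddCommGroup E] [InnerProductSpace ℝ E]
  {F u : EuclideanSpace ℝ (Fin n) → E} {y : EuclideanSpace ℝ (Fin n)}

/-! The proof is a localized maximum principle. Three facts enter: `Δf = nH`, `ΔH = 0`, and `H` is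
normal to `M`. Differentiating `⟪H, ∂f⟫ = 0` and tracing gives `∑ ⟪DH(eₐ), Df(eₐ)⟫ = -n|H|²`, so by
Cauchy–Schwarz `|DH|² ≥ n|H|⁴` (`card_mul_norm_pow_four_le`). Hence `Δ|H|² = 2|DH|² ≥ 2n|H|⁴`, a
superlinear inequality of Keller–Osserman type, which forces a local bound on `|H|`.

To extract the bound, take the cutoff `v = R² - |f|²` and maximize `v²|H|²` over `f⁻¹` of the closed
`R`-ball, which is compact because `f` is proper. Since `Δv = -2n(1 + ⟪f, H⟫)` and `|∇v|² ≤ 4|f|²`,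
the first and second order conditions at an interior maximum give `v|H| ≤ 5R` there
(`mul_norm_le_of_isLocalMax`), hence on the whole preimage of the ball. At a fixed point, `|H| ≤ 5R
/ (R² - |f|²)`, which tends to `0` as `R` grows.

All computations take place at a single point of a chart, where the Laplacian is `u ↦ ∑ D²u(eₐ, eₐ)
- Du(w)` with fixed vectors `eₐ` and `w` (`frameLaplacian`). No moving frame or connection is
needed. -/

theorem fderiv_fderiv_apply {V W : Type*} [NormedAddCommGroup V] [NormedSpace ℝ V]
    [NormedAddCommGroup W] [NormedSpace ℝ W] {u : V → W} {y : V} (hu : ContDiffAt ℝ 2 u y)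
    (a b : V) : fderiv ℝ (fun z => fderiv ℝ u z b) y a = fderiv ℝ (fderiv ℝ u) y a b := by
  have h : DifferentiableAt ℝ (fderiv ℝ u) y :=
    (hu.fderiv_right (m := 1) (by norm_num)).differentiableAt (by norm_num)
  rw [fderiv_clm_apply h (differentiableAt_const b)]
  simp

theorem pderiv_pderiv (hu : ContDiffAt ℝ 2 u y) (i j : Fin n) :
    pderiv i (pderiv j u) y =
      fderiv ℝ (fderiv ℝ u) y (EuclideanSpace.single i 1) (EuclideanSpace.single j 1) :=
  fderiv_fderiv_apply hu _ _

theorem pderiv_comm (hu : ContDiffAt ℝ 2 u y) (i j : Fin n) :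
    pderiv i (pderiv j u) y = pderiv j (pderiv i u) y := by
  rw [pderiv_pderiv hu, pderiv_pderiv hu]
  exact (hu.isSymmSndFDerivAt (by simp)).eq _ _

theorem contDiffAt_pderiv {m : ℕ∞ω} {k : ℕ∞ω} (hu : ContDiffAt ℝ k u y) (h : m + 1 ≤ k)
    (i : Fin n) : ContDiffAt ℝ m (pderiv i u) y :=
  (hu.fderiv_right h).clm_apply contDiffAt_const

theorem eq_sum_single (v : EuclideanSpace ℝ (Fin n)) :
    v = ∑ i, v i • EuclideanSpace.single i (1 : ℝ) := by
  ext j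
  simp [Pi.single_apply]

/-- Vectors that the differential of `F` maps to an orthonormal family. -/
def IsOrthonormalFrame (F : EuclideanSpace ℝ (Fin n) → E) (y : EuclideanSpace ℝ (Fin n))
    (e : Fin n → EuclideanSpace ℝ (Fin n)) : Prop :=
  Orthonormal ℝ fun a => fderiv ℝ F y (e a)

theorem exists_isOrthonormalFrame (h : Function.Injective (fderiv ℝ F y)) :
    ∃ e, IsOrthonormalFrame F y e := by
  have hd : Module.finrank ℝ (LinearMap.range (fderiv ℝ F y).toLinearMap) = n := by
    rw [LinearMap.finrank_range_of_inj h]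
    simp
  let b := (stdOrthonormalBasis ℝ (LinearMap.range (fderiv ℝ F y).toLinearMap)).reindex
    (finCongr hd)
  choose e he using fun a => (b a).2
  refine ⟨e, ?_⟩
  have hb := b.orthonormal.comp_linearIsometry
    (LinearMap.range (fderiv ℝ F y).toLinearMap).subtypeₗᵢ
  unfold IsOrthonormalFrame
  convert hb using 2 with a
  exact he a

/-- If `A` has the frame vectors as columns, orthonormality reads `Aᵀ g A = 1`, so `g⁻¹ = A Aᵀ`. -/
theorem IsOrthonormalFrame.inv_inducedMetric {e : Fin n → EuclideanSpace ℝ (Fin n)}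
    (he : IsOrthonormalFrame F y e) :
    inducedMetric F y * (inducedMetric F y)⁻¹ = 1 ∧
      ∀ i j, (inducedMetric F y)⁻¹ i j = ∑ a, e a i * e a j := by
  let A : Matrix (Fin n) (Fin n) ℝ := Matrix.of fun i a => e a i
  have h1 : A.transpose * (inducedMetric F y * A) = 1 := by
    ext a b
    have h := orthonormal_iff_ite.1 he a b
    have h' (c : Fin n) : fderiv ℝ F y (e c) = ∑ i, e c i • pderiv i F y := by
      conv_lhs => rw [eq_sum_single (e c), map_sum]
      simp only [map_smul, pderiv]
    rw [Matrix.one_apply, ← h, h', h', sum_inner]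
    simp only [inner_sum, inner_smul_left, inner_smul_right, Matrix.mul_apply, Finset.mul_sum,
      Matrix.transpose_apply, A, Matrix.of_apply, inducedMetric]
    refine Finset.sum_congr rfl fun i _ => Finset.sum_congr rfl fun j _ => ?_
    simp only [conj_trivial]
    ring
  have h2 : inducedMetric F y * (A * A.transpose) = 1 := by
    rw [← Matrix.mul_assoc]
    exact mul_eq_one_comm.1 h1
  have h3 := Matrix.inv_eq_right_inv h2
  refine ⟨by rw [h3, h2], fun i j => ?_⟩
  rw [h3]
  simp [A, Matrix.mul_apply]

theorem IsOrthonormalFrame.trace {W : Type*} [NormedAddCommGroup W] [NormedSpace ℝ W]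
    {e : Fin n → EuclideanSpace ℝ (Fin n)} (he : IsOrthonormalFrame F y e)
    (B : EuclideanSpace ℝ (Fin n) →L[ℝ] EuclideanSpace ℝ (Fin n) →L[ℝ] W) :
    ∑ i, ∑ j, (inducedMetric F y)⁻¹ i j •
      B (EuclideanSpace.single i 1) (EuclideanSpace.single j 1) = ∑ a, B (e a) (e a) := by
  have h (a : Fin n) : B (e a) (e a) = ∑ i, ∑ j, (e a i * e a j) •
      B (EuclideanSpace.single i 1) (EuclideanSpace.single j 1) := by
    conv_lhs => rw [eq_sum_single (e a)]
    simp only [map_sum, map_smul, sum_apply, smul_apply, Finset.smul_sum, smul_smul]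
    rw [Finset.sum_comm]
    simp only [mul_comm]
  simp only [h, he.inv_inducedMetric.2, Finset.sum_smul]
  conv_rhs => rw [Finset.sum_comm]
  refine Finset.sum_congr rfl fun i _ => ?_
  rw [Finset.sum_comm]

/-- The operator `u ↦ ∑ₐ D²u(eₐ, eₐ) - Du(w)`. -/
def frameLaplacian {V W ι : Type*} [NormedAddCommGroup V] [NormedSpace ℝ V]
    [NormedAddCommGroup W] [NormedSpace ℝ W] [Fintype ι] (e : ι → V) (w : V) (u : V → W) (y : V) :
    W :=
  ∑ a, fderiv ℝ (fderiv ℝ u) y (e a) (e a) - fderiv ℝ u y w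

/-- The first-order coefficient `∑ gⁱʲ Γᵏᵢⱼ ∂ₖ` of the Laplacian. -/
def laplacianDrift (g : EuclideanSpace ℝ (Fin n) → Matrix (Fin n) (Fin n) ℝ)
    (y : EuclideanSpace ℝ (Fin n)) : EuclideanSpace ℝ (Fin n) :=
  ∑ i, ∑ j, (g y)⁻¹ i j • ∑ k, christoffel g k i j y • EuclideanSpace.single k (1 : ℝ)

theorem IsOrthonormalFrame.coordLaplacian_eq {e : Fin n → EuclideanSpace ℝ (Fin n)}
    (he : IsOrthonormalFrame F y e) (hu : ContDiffAt ℝ 2 u y) :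
    coordLaplacian (inducedMetric F) u y =
      frameLaplacian e (laplacianDrift (inducedMetric F) y) u y := by
  simp only [coordLaplacian, frameLaplacian, ← he.trace, laplacianDrift, map_sum, map_smul,
    smul_sub, Finset.sum_sub_distrib, pderiv_pderiv hu]
  rfl

theorem IsOrthonormalFrame.coordMeanCurvature_eq [CompleteSpace E]
    {e : Fin n → EuclideanSpace ℝ (Fin n)}
    (he : IsOrthonormalFrame F y e) (hF : ContDiffAt ℝ 2 F y) :
    coordMeanCurvature F y = (n : ℝ)⁻¹ • ∑ a,
      (LinearMap.range (fderiv ℝ F y).toLinearMap)ᗮ.starProjection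
        (fderiv ℝ (fderiv ℝ F) y (e a) (e a)) := by
  simp only [coordMeanCurvature, coordSecondFundamentalForm, pderiv_pderiv hF]
  rw [← map_sum, ← he.trace]
  simp only [map_sum, map_smul]

theorem inner_coordMeanCurvature_fderiv (v : EuclideanSpace ℝ (Fin n)) :
    ⟪coordMeanCurvature F y, fderiv ℝ F y v⟫_ℝ = 0 := by
  rw [real_inner_comm]
  refine (Submodule.mem_orthogonal _ (coordMeanCurvature F y)).1 ?_ _
    (LinearMap.mem_range_self (fderiv ℝ F y).toLinearMap v)
  exact Submodule.smul_mem _ _ (Submodule.sum_mem _ fun i _ => Submodule.sum_mem _ fun j _ =>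
    Submodule.smul_mem _ _ (Submodule.starProjection_apply_mem _ _))

theorem pderiv_inducedMetric (hF : ContDiffAt ℝ 2 F y) (i j l : Fin n) :
    pderiv i (fun z => inducedMetric F z j l) y =
      ⟪pderiv i (pderiv j F) y, pderiv l F y⟫_ℝ + ⟪pderiv j F y, pderiv i (pderiv l F) y⟫_ℝ := by
  have h (k : Fin n) : DifferentiableAt ℝ (pderiv k F) y :=
    (contDiffAt_pderiv (m := 1) hF (by norm_num) k).differentiableAt (by norm_num)
  simp only [inducedMetric, Matrix.of_apply]
  rw [pderiv, fderiv_inner_apply ℝ (h j) (h l), add_comm]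
  rfl

/-- Inserting `∂ᵢgⱼₗ = ⟪∂ᵢ∂ⱼF, ∂ₗF⟫ + ⟪∂ⱼF, ∂ᵢ∂ₗF⟫` into the Christoffel symbols leaves `Γᵏᵢⱼ = ∑
gᵏˡ ⟪∂ᵢ∂ⱼF, ∂ₗF⟫`, so `∑ Γᵏᵢⱼ ∂ₖF` is the tangential part of `∂ᵢ∂ⱼF`. -/
theorem coordSecondFundamentalForm_eq (hF : ContDiffAt ℝ 2 F y)
    (hinj : Function.Injective (fderiv ℝ F y)) (i j : Fin n) :
    coordSecondFundamentalForm F i j y =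
      pderiv i (pderiv j F) y - ∑ k, christoffel (inducedMetric F) k i j y • pderiv k F y := by
  obtain ⟨e, he⟩ := exists_isOrthonormalFrame hinj
  have hΓ (k : Fin n) : christoffel (inducedMetric F) k i j y =
      ∑ l, (inducedMetric F y)⁻¹ k l * ⟪pderiv i (pderiv j F) y, pderiv l F y⟫_ℝ := by
    rw [christoffel, Finset.mul_sum]
    refine Finset.sum_congr rfl fun l _ => ?_
    rw [pderiv_inducedMetric hF, pderiv_inducedMetric hF, pderiv_inducedMetric hF,
      pderiv_comm hF j i, pderiv_comm hF l i, pderiv_comm hF l j,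
      real_inner_comm (pderiv i (pderiv l F) y), real_inner_comm (pderiv j (pderiv l F) y)]
    ring
  have hmem : ∑ k, christoffel (inducedMetric F) k i j y • pderiv k F y ∈
      LinearMap.range (fderiv ℝ F y).toLinearMap :=
    Submodule.sum_mem _ fun k _ => Submodule.smul_mem _ _ ⟨_, rfl⟩
  have horth (m : Fin n) : ⟪pderiv i (pderiv j F) y -
      ∑ k, christoffel (inducedMetric F) k i j y • pderiv k F y, pderiv m F y⟫_ℝ = 0 := by
    have h1 := congrFun (congrFun (congrArg (fun A => A.mulVec) he.inv_inducedMetric.1)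
      (fun l => ⟪pderiv i (pderiv j F) y, pderiv l F y⟫_ℝ)) m
    rw [← Matrix.mulVec_mulVec, Matrix.one_mulVec] at h1
    rw [inner_sub_left, ← h1, sum_inner, sub_eq_zero]
    simp only [Matrix.mulVec, dotProduct]
    refine Finset.sum_congr rfl fun k _ => ?_
    rw [inner_smul_left, hΓ, real_inner_comm]
    simp [inducedMetric, mul_comm]
  rw [coordSecondFundamentalForm]
  refine Submodule.eq_starProjection_of_mem_of_inner_eq_zero ?_ fun v hv => ?_
  · rw [Submodule.mem_orthogonal]
    rintro _ ⟨v, rfl⟩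
    rw [eq_sum_single v, map_sum, sum_inner]
    refine Finset.sum_eq_zero fun m _ => ?_
    rw [map_smul, inner_smul_left, real_inner_comm]
    exact mul_eq_zero_of_right _ (horth m)
  · rw [sub_sub_cancel]
    exact (Submodule.mem_orthogonal _ v).1 hv _ hmem

theorem coordLaplacian_self (hF : ContDiffAt ℝ 2 F y)
    (hinj : Function.Injective (fderiv ℝ F y)) :
    coordLaplacian (inducedMetric F) F y = (n : ℝ) • coordMeanCurvature F y := by
  -- For `n = 0` the factor `n⁻¹` does not cancel, but the sums are empty.
  rcases Nat.eq_zero_or_pos n with rfl | hn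
  · simp [coordLaplacian]
  · rw [coordMeanCurvature, smul_inv_smul₀ (by positivity)]
    simp only [coordLaplacian, coordSecondFundamentalForm_eq hF hinj]

theorem contDiffAt_det {V : Type*} [NormedAddCommGroup V] [NormedSpace ℝ V] {m : ℕ∞ω}
    {A : V → Matrix (Fin n) (Fin n) ℝ} {y : V}
    (hA : ∀ i j, ContDiffAt ℝ m (fun z => A z i j) y) : ContDiffAt ℝ m (fun z => (A z).det) y := by
  simp only [Matrix.det_apply']
  exact ContDiffAt.sum fun σ _ => contDiffAt_const.mul (contDiffAt_prod fun i _ => hA _ _)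

theorem contDiffAt_inv_apply {V : Type*} [NormedAddCommGroup V] [NormedSpace ℝ V] {m : ℕ∞ω}
    {A : V → Matrix (Fin n) (Fin n) ℝ} {y : V}
    (hA : ∀ i j, ContDiffAt ℝ m (fun z => A z i j) y) (h0 : (A y).det ≠ 0) (i j : Fin n) :
    ContDiffAt ℝ m (fun z => (A z)⁻¹ i j) y := by
  simp only [Matrix.inv_def, Matrix.smul_apply, Matrix.adjugate_apply, Ring.inverse_eq_inv',
    smul_eq_mul]
  refine ((contDiffAt_det hA).inv h0).mul (contDiffAt_det fun k l => ?_)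
  by_cases h : k = j
  · subst h
    simpa using contDiffAt_const
  · simpa [Matrix.updateRow_ne h] using hA k l

/-- The projection onto a varying normal space is not visibly smooth in the point. The Christoffel
expression for `h` is, its only division being by `det g ≠ 0`. -/
theorem contDiffAt_coordMeanCurvature
    (hF : ∀ᶠ z in 𝓝 y, ContDiffAt ℝ ∞ F z ∧ Function.Injective (fderiv ℝ F z)) :
    ContDiffAt ℝ 2 (coordMeanCurvature F) y := by
  obtain ⟨e, he⟩ := exists_isOrthonormalFrame hF.self_of_nhds.2
  have h4 : ContDiffAt ℝ 4 F y := by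
    exact_mod_cast contDiffAt_infty.1 hF.self_of_nhds.1 4
  have h3 (i : Fin n) : ContDiffAt ℝ 3 (pderiv i F) y := contDiffAt_pderiv h4 (by norm_num) i
  have h2 (i : Fin n) : ContDiffAt ℝ 2 (pderiv i F) y := (h3 i).of_le (by norm_num)
  have hg3 (i j : Fin n) : ContDiffAt ℝ 3 (fun z => inducedMetric F z i j) y :=
    (h3 i).inner ℝ (h3 j)
  have hdet : (inducedMetric F y).det ≠ 0 := by
    intro h0
    simpa [h0] using congrArg Matrix.det he.inv_inducedMetric.1
  have hinv (i j : Fin n) : ContDiffAt ℝ 2 (fun z => (inducedMetric F z)⁻¹ i j) y :=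
    (contDiffAt_inv_apply hg3 hdet i j).of_le (by norm_num)
  have hΓ (k i j : Fin n) : ContDiffAt ℝ 2 (christoffel (inducedMetric F) k i j) y :=
    contDiffAt_const.mul (ContDiffAt.sum fun l _ => (hinv k l).mul
      (((contDiffAt_pderiv (hg3 j l) (by norm_num) i).add
        (contDiffAt_pderiv (hg3 i l) (by norm_num) j)).sub
        (contDiffAt_pderiv (hg3 i j) (by norm_num) l)))
  have hmain : ContDiffAt ℝ 2
      (fun z => (n : ℝ)⁻¹ • coordLaplacian (inducedMetric F) F z) y :=
    contDiffAt_const.smul (ContDiffAt.sum fun i _ => ContDiffAt.sum fun j _ =>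
      (hinv i j).smul ((contDiffAt_pderiv (h3 j) (by norm_num) i).sub
        (ContDiffAt.sum fun k _ => (hΓ k i j).smul (h2 k))))
  refine hmain.congr_of_eventuallyEq (hF.mono fun z hz => ?_)
  have hz2 : ContDiffAt ℝ 2 F z := by exact_mod_cast contDiffAt_infty.1 hz.1 2
  simp only [coordMeanCurvature, coordLaplacian,
    coordSecondFundamentalForm_eq hz2 hz.2]

theorem starProjection_orthogonal_congr {K K' : Submodule ℝ E} [Kᗮ.HasOrthogonalProjection]
    [K'ᗮ.HasOrthogonalProjection] (h : K = K') : Kᗮ.starProjection = K'ᗮ.starProjection := by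
  subst h
  rfl

/-- Under a change of coordinates `τ`, the second derivative of `F` acquires the extra term
`DF(D²τ(a, a))`. It is tangent, so the normal projection kills it, and `Dτ` carries an orthonormal
frame to an orthonormal frame. -/
theorem coordMeanCurvature_comp [CompleteSpace E] {G : EuclideanSpace ℝ (Fin n) → E}
    {τ : EuclideanSpace ℝ (Fin n) → EuclideanSpace ℝ (Fin n)}
    (hF : ContDiffAt ℝ 2 F (τ y)) (hτ : ContDiffAt ℝ 2 τ y)
    (hG : G =ᶠ[𝓝 y] F ∘ τ) (hinj : Function.Injective (fderiv ℝ G y)) :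
    coordMeanCurvature G y = coordMeanCurvature F (τ y) := by
  have hF1 : DifferentiableAt ℝ F (τ y) := hF.differentiableAt (by norm_num)
  have hτ1 : DifferentiableAt ℝ τ y := hτ.differentiableAt (by norm_num)
  have hcomp : fderiv ℝ G y = (fderiv ℝ F (τ y)).comp (fderiv ℝ τ y) :=
    hG.fderiv_eq.trans (fderiv_comp y hF1 hτ1)
  obtain ⟨e, he⟩ := exists_isOrthonormalFrame hinj
  have he' : IsOrthonormalFrame F (τ y) fun a => fderiv ℝ τ y (e a) := by
    unfold IsOrthonormalFrame at he ⊢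
    simpa [hcomp] using he
  have hτinj : Function.Injective (fderiv ℝ τ y) := by
    rw [hcomp] at hinj
    exact Function.Injective.of_comp (f := fderiv ℝ F (τ y)) hinj
  have hτsurj : Function.Surjective (fderiv ℝ τ y).toLinearMap :=
    LinearMap.injective_iff_surjective.1 hτinj
  have hrange : LinearMap.range (fderiv ℝ G y).toLinearMap =
      LinearMap.range (fderiv ℝ F (τ y)).toLinearMap := by
    rw [hcomp]
    exact LinearMap.range_comp_of_range_eq_top _ (LinearMap.range_eq_top.2 hτsurj)
  have hsecond (a : EuclideanSpace ℝ (Fin n)) : fderiv ℝ (fderiv ℝ G) y a a =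
      fderiv ℝ (fderiv ℝ F) (τ y) (fderiv ℝ τ y a) (fderiv ℝ τ y a) +
        fderiv ℝ F (τ y) (fderiv ℝ (fderiv ℝ τ) y a a) := by
    have hev : fderiv ℝ (F ∘ τ) =ᶠ[𝓝 y] fun z => (fderiv ℝ F (τ z)).comp (fderiv ℝ τ z) := by
      have h1 := hτ1.continuousAt.eventually
        ((hF.eventually (by simp)).mono fun z hz => hz.differentiableAt (by norm_num))
      have h2 := (hτ.eventually (by simp)).mono fun z hz =>
        hz.differentiableAt (by norm_num : (2 : ℕ∞ω) ≠ 0)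
      filter_upwards [h1, h2] with z hz1 hz2 using fderiv_comp z hz1 hz2
    have hDF : DifferentiableAt ℝ (fderiv ℝ F) (τ y) :=
      (hF.fderiv_right (m := 1) (by norm_num)).differentiableAt (by norm_num)
    have hDτ : DifferentiableAt ℝ (fderiv ℝ τ) y :=
      (hτ.fderiv_right (m := 1) (by norm_num)).differentiableAt (by norm_num)
    rw [hG.fderiv.fderiv_eq, hev.fderiv_eq, fderiv_clm_comp (c := fun z => fderiv ℝ F (τ z)) (hDF.comp y hτ1) hDτ]
    have h3 : fderiv ℝ (fun z => fderiv ℝ F (τ z)) y =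
      (fderiv ℝ (fderiv ℝ F) (τ y)).comp (fderiv ℝ τ y) := fderiv_comp y hDF hτ1
    simp [h3, add_comm]
  rw [he.coordMeanCurvature_eq ((hF.comp y hτ).congr_of_eventuallyEq hG), he'.coordMeanCurvature_eq hF]
  congr 1
  refine Finset.sum_congr rfl fun a _ => ?_
  rw [starProjection_orthogonal_congr hrange, hsecond, map_add, add_eq_left, Submodule.starProjection_apply_eq_zero_iff]
  exact Submodule.le_orthogonal_orthogonal _ ⟨_, rfl⟩

end Coordinates

/-! ### Pointwise calculus for `frameLaplacian` and the estimate at a local maximum. -/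

section MaximumPrinciple

variable {V E ι : Type*} [NormedAddCommGroup V] [NormedSpace ℝ V] [NormedAddCommGroup E]
  [InnerProductSpace ℝ E] [Fintype ι] {y : V}

theorem fderiv_fderiv_inner {p q : V → E} (hp : ContDiffAt ℝ 2 p y) (hq : ContDiffAt ℝ 2 q y)
    (a : V) : fderiv ℝ (fderiv ℝ fun z => ⟪p z, q z⟫_ℝ) y a a =
      ⟪fderiv ℝ (fderiv ℝ p) y a a, q y⟫_ℝ + ⟪p y, fderiv ℝ (fderiv ℝ q) y a a⟫_ℝ +
        2 * ⟪fderiv ℝ p y a, fderiv ℝ q y a⟫_ℝ := by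
  have hdiff {r : V → E} (hr : ContDiffAt ℝ 2 r y) : ∀ᶠ z in 𝓝 y, DifferentiableAt ℝ r z :=
    (hr.eventually (by simp)).mono fun z hz => hz.differentiableAt (by norm_num)
  have hev : (fun z => fderiv ℝ (fun z => ⟪p z, q z⟫_ℝ) z a) =ᶠ[𝓝 y]
      fun z => ⟪p z, fderiv ℝ q z a⟫_ℝ + ⟪fderiv ℝ p z a, q z⟫_ℝ := by
    filter_upwards [hdiff hp, hdiff hq] with z h1 h2 using fderiv_inner_apply ℝ h1 h2 a
  have hd {r : V → E} (hr : ContDiffAt ℝ 2 r y) :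
      DifferentiableAt ℝ (fun z => fderiv ℝ r z a) y :=
    ((hr.fderiv_right (m := 1) (by norm_num)).differentiableAt (by norm_num)).clm_apply
      (differentiableAt_const a)
  have hp1 := (hdiff hp).self_of_nhds
  have hq1 := (hdiff hq).self_of_nhds
  rw [← fderiv_fderiv_apply (hp.inner ℝ hq), hev.fderiv_eq,
    fderiv_fun_add (hp1.inner ℝ (hd hq)) ((hd hp).inner ℝ hq1), add_apply,
    fderiv_inner_apply ℝ hp1 (hd hq), fderiv_inner_apply ℝ (hd hp) hq1, fderiv_fderiv_apply hp,
    fderiv_fderiv_apply hq]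
  ring

theorem frameLaplacian_inner (e : ι → V) (w : V) {p q : V → E} (hp : ContDiffAt ℝ 2 p y)
    (hq : ContDiffAt ℝ 2 q y) : frameLaplacian e w (fun z => ⟪p z, q z⟫_ℝ) y =
      ⟪frameLaplacian e w p y, q y⟫_ℝ + ⟪p y, frameLaplacian e w q y⟫_ℝ +
        2 * ∑ a, ⟪fderiv ℝ p y (e a), fderiv ℝ q y (e a)⟫_ℝ := by
  simp only [frameLaplacian, fderiv_fderiv_inner hp hq, inner_sub_left, inner_sub_right,
    sum_inner, inner_sum, Finset.sum_add_distrib, Finset.mul_sum,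
    fderiv_inner_apply ℝ (hp.differentiableAt (by norm_num)) (hq.differentiableAt (by norm_num))]
  ring

theorem frameLaplacian_mul (e : ι → V) (w : V) {p q : V → ℝ} (hp : ContDiffAt ℝ 2 p y)
    (hq : ContDiffAt ℝ 2 q y) : frameLaplacian e w (fun z => p z * q z) y =
      frameLaplacian e w p y * q y + p y * frameLaplacian e w q y +
        2 * ∑ a, fderiv ℝ p y (e a) * fderiv ℝ q y (e a) := by
  have h := frameLaplacian_inner e w hq hp
  simp only [RCLike.inner_apply, conj_trivial] at h
  rw [h]
  ring

theorem frameLaplacian_const_sub (e : ι → V) (w : V) (c : ℝ) (p : V → ℝ) :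
    frameLaplacian e w (fun z => c - p z) y = -frameLaplacian e w p y := by
  have h : fderiv ℝ (fun z => c - p z) = fun z => -fderiv ℝ p z := by
    ext1 z
    exact fderiv_const_sub c
  simp only [frameLaplacian, h, fderiv_fun_neg, neg_apply, Finset.sum_neg_distrib]
  ring

theorem fderiv_fderiv_nonpos_of_isLocalMax {ψ : V → ℝ} (hψ : ContDiffAt ℝ 2 ψ y)
    (h : IsLocalMax ψ y) (a : V) : fderiv ℝ (fderiv ℝ ψ) y a a ≤ 0 := by
  have hline (t : ℝ) : HasDerivAt (fun t : ℝ => y + t • a) a t := by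
    simpa using ((hasDerivAt_id t).smul_const a).const_add y
  have hcont : Tendsto (fun t : ℝ => y + t • a) (𝓝 0) (𝓝 y) := by
    simpa using (hline 0).continuousAt.tendsto
  have hy : y + (0 : ℝ) • a = y := by simp
  have hd1 : deriv (fun t : ℝ => ψ (y + t • a)) =ᶠ[𝓝 0] fun t => fderiv ℝ ψ (y + t • a) a := by
    have hev := hcont.eventually (hψ.eventually (by simp))
    filter_upwards [hev] with t ht
    exact ((ht.differentiableAt (by norm_num)).hasFDerivAt.comp_hasDerivAt t (hline t)).deriv
  have hd2 : deriv (deriv fun t : ℝ => ψ (y + t • a)) 0 = fderiv ℝ (fderiv ℝ ψ) y a a := by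
    rw [hd1.deriv_eq, ← fderiv_fderiv_apply hψ]
    have hd : DifferentiableAt ℝ (fun z => fderiv ℝ ψ z a) (y + (0 : ℝ) • a) := by
      rw [hy]
      exact ((hψ.fderiv_right (m := 1) (by norm_num)).differentiableAt (by norm_num)).clm_apply
        (differentiableAt_const a)
    have h2 := (hd.hasFDerivAt.comp_hasDerivAt (0 : ℝ) (hline 0)).deriv
    rw [hy] at h2
    exact h2
  have hmax : IsLocalMax (fun t : ℝ => ψ (y + t • a)) 0 := by
    have := hcont.eventually h
    simpa [IsLocalMax, IsMaxFilter] using this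
  -- A positive second derivative would make `0` also a local minimum along the line; the
  -- restriction would then be locally constant, with zero second derivative.
  by_contra! hpos
  rw [← hd2] at hpos
  have hc : ContinuousAt (fun t : ℝ => ψ (y + t • a)) 0 := by
    refine ContinuousAt.comp (g := ψ) ?_ (hline 0).continuousAt
    rw [hy]
    exact hψ.continuousAt
  have hmin := isLocalMin_of_deriv_deriv_pos hpos hmax.deriv_eq_zero hc
  have hconst : (fun t : ℝ => ψ (y + t • a)) =ᶠ[𝓝 0] fun _ => ψ (y + (0 : ℝ) • a) := by
    filter_upwards [hmax, hmin] with t h1 h2 using le_antisymm h1 h2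
  have h0 := hconst.deriv.deriv_eq
  rw [h0] at hpos
  simp at hpos

theorem frameLaplacian_nonpos_of_isLocalMax (e : ι → V) (w : V) {ψ : V → ℝ}
    (hψ : ContDiffAt ℝ 2 ψ y) (h : IsLocalMax ψ y) : frameLaplacian e w ψ y ≤ 0 := by
  rw [frameLaplacian, h.fderiv_eq_zero]
  simpa using Finset.sum_nonpos fun a _ => fderiv_fderiv_nonpos_of_isLocalMax hψ h (e a)

variable {F H : V → E} {e : ι → V} {w : V}

/-- For a normal field `H` with `ΔH = 0` and `ΔF = nH`, the norm of `DH` dominates `√n |H|²`. -/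
theorem card_mul_norm_pow_four_le (hF : ContDiffAt ℝ 2 F y) (hH : ContDiffAt ℝ 2 H y)
    (he : Orthonormal ℝ fun a => fderiv ℝ F y (e a))
    (hLF : frameLaplacian e w F y = (Fintype.card ι : ℝ) • H y)
    (hperp : ∀ᶠ z in 𝓝 y, ∀ v, ⟪H z, fderiv ℝ F z v⟫_ℝ = 0) :
    (Fintype.card ι : ℝ) * (‖H y‖ ^ 2) ^ 2 ≤ ∑ a, ‖fderiv ℝ H y (e a)‖ ^ 2 := by
  have hd (a : V) : DifferentiableAt ℝ (fun z => fderiv ℝ F z a) y :=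
    ((hF.fderiv_right (m := 1) (by norm_num)).differentiableAt (by norm_num)).clm_apply
      (differentiableAt_const a)
  have h1 (a : ι) : ⟪fderiv ℝ H y (e a), fderiv ℝ F y (e a)⟫_ℝ =
      -⟪H y, fderiv ℝ (fderiv ℝ F) y (e a) (e a)⟫_ℝ := by
    have hev : (fun z => ⟪H z, fderiv ℝ F z (e a)⟫_ℝ) =ᶠ[𝓝 y] fun _ => 0 :=
      hperp.mono fun z hz => hz (e a)
    have h := fderiv_inner_apply ℝ (hH.differentiableAt (by norm_num)) (hd (e a)) (e a)
    rw [hev.fderiv_eq, fderiv_fderiv_apply hF] at h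
    simp only [fderiv_fun_const, Pi.zero_apply, zero_apply] at h
    linarith
  have h2 : ∑ a, ⟪fderiv ℝ H y (e a), fderiv ℝ F y (e a)⟫_ℝ =
      -((Fintype.card ι : ℝ) * ‖H y‖ ^ 2) := by
    simp only [h1, Finset.sum_neg_distrib, ← inner_sum]
    -- The trace of `D²F` is `ΔF + DF(w)`, and the drift term is tangent, hence orthogonal to `H`.
    rw [← sub_add_cancel (∑ a, fderiv ℝ (fderiv ℝ F) y (e a) (e a)) (fderiv ℝ F y w)]
    change -⟪H y, frameLaplacian e w F y + _⟫_ℝ = _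
    rw [inner_add_right, hperp.self_of_nhds, hLF, inner_smul_right, real_inner_self_eq_norm_sq,
      add_zero]
  have h3 : ((Fintype.card ι : ℝ) * ‖H y‖ ^ 2) ^ 2 ≤
      Fintype.card ι * ∑ a, ‖fderiv ℝ H y (e a)‖ ^ 2 := by
    rw [← neg_sq, ← h2]
    refine (sq_sum_le_card_mul_sum_sq (s := Finset.univ)).trans ?_
    rw [Finset.card_univ]
    refine mul_le_mul_of_nonneg_left (Finset.sum_le_sum fun a _ => ?_) (Nat.cast_nonneg _)
    rw [sq_le_sq, abs_norm]
    simpa [he.1 a] using abs_real_inner_le_norm (fderiv ℝ H y (e a)) (fderiv ℝ F y (e a))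
  rcases Nat.eq_zero_or_pos (Fintype.card ι) with h0 | h0
  · rw [h0, Nat.cast_zero, zero_mul]
    positivity
  · have h0' : (0 : ℝ) < Fintype.card ι := by exact_mod_cast h0
    refine le_of_mul_le_mul_left ?_ h0'
    linarith

/-- With `u = |H|²`, `S = |DH|²` and `K = |∇v|²`, the critical point equation `v∇u = -2u∇v` turns
`Δ(v²u) ≤ 0` into `v²S ≤ u(3K - vΔv)`. Then `S ≥ nu²` makes this a quadratic inequality for `v|H|`.
-/
theorem mul_norm_le_of_isLocalMax [Nonempty ι] (hF : ContDiffAt ℝ 2 F y)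
    (hH : ContDiffAt ℝ 2 H y) (he : Orthonormal ℝ fun a => fderiv ℝ F y (e a))
    (hLF : frameLaplacian e w F y = (Fintype.card ι : ℝ) • H y)
    (hLH : frameLaplacian e w H y = 0)
    (hperp : ∀ᶠ z in 𝓝 y, ∀ v, ⟪H z, fderiv ℝ F z v⟫_ℝ = 0) {R : ℝ} (hR : ‖F y‖ < R)
    (hmax : IsLocalMax (fun z => (R ^ 2 - ‖F z‖ ^ 2) ^ 2 * ‖H z‖ ^ 2) y) :
    (R ^ 2 - ‖F y‖ ^ 2) * ‖H y‖ ≤ 5 * R := by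
  have hR0 : 0 < R := (norm_nonneg _).trans_lt hR
  rcases eq_or_ne (H y) 0 with hH0 | hH0
  · rw [hH0, norm_zero, mul_zero]
    positivity
  have hv0 : 0 < R ^ 2 - ‖F y‖ ^ 2 := by nlinarith [norm_nonneg (F y)]
  have hh0 : 0 < ‖H y‖ := norm_pos_iff.2 hH0
  set n : ℝ := (Fintype.card ι : ℝ) with hn
  have hn1 : 1 ≤ n := by
    rw [hn]
    exact_mod_cast Fintype.card_pos (α := ι)
  let u : V → ℝ := fun z => ⟪H z, H z⟫_ℝ
  let v : V → ℝ := fun z => R ^ 2 - ⟪F z, F z⟫_ℝ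
  have hu : ContDiffAt ℝ 2 u y := hH.inner ℝ hH
  have hFF : ContDiffAt ℝ 2 (fun z => ⟪F z, F z⟫_ℝ) y := hF.inner ℝ hF
  have hv : ContDiffAt ℝ 2 v y := contDiffAt_const.sub hFF
  have hu1 : DifferentiableAt ℝ u y := hu.differentiableAt (by norm_num)
  have hv1 : DifferentiableAt ℝ v y := hv.differentiableAt (by norm_num)
  have hF1 : DifferentiableAt ℝ F y := hF.differentiableAt (by norm_num)
  have huy : u y = ‖H y‖ ^ 2 := real_inner_self_eq_norm_sq _
  have hvy : v y = R ^ 2 - ‖F y‖ ^ 2 := by simp only [v, real_inner_self_eq_norm_sq]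
  have hmax' : IsLocalMax (fun z => v z * v z * u z) y := by
    convert hmax using 2 with z
    simp only [u, v, real_inner_self_eq_norm_sq]
    ring
  have hLu : frameLaplacian e w u y = 2 * ∑ a, ‖fderiv ℝ H y (e a)‖ ^ 2 := by
    simp only [u]
    rw [frameLaplacian_inner e w hH hH, hLH]
    simp only [inner_zero_left, inner_zero_right, real_inner_self_eq_norm_sq]
    ring
  have hLv : frameLaplacian e w v y = -(2 * n * ⟪F y, H y⟫_ℝ + 2 * n) := by
    simp only [v]
    rw [frameLaplacian_const_sub, frameLaplacian_inner e w hF hF, hLF, inner_smul_left,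
      inner_smul_right, real_inner_comm (F y) (H y)]
    simp only [real_inner_self_eq_norm_sq, he.1, conj_trivial, one_pow, Finset.sum_const,
      Finset.card_univ, nsmul_eq_mul, ← hn]
    ring
  have hva (a : ι) : fderiv ℝ v y (e a) = -(2 * ⟪fderiv ℝ F y (e a), F y⟫_ℝ) := by
    simp only [v]
    rw [fderiv_const_sub, neg_apply, fderiv_inner_apply ℝ hF1 hF1,
      real_inner_comm (fderiv ℝ F y (e a)) (F y)]
    ring
  -- Bessel's inequality for the orthonormal vectors `DF(eₐ)`.
  have hK : ∑ a, fderiv ℝ v y (e a) ^ 2 ≤ 4 * ‖F y‖ ^ 2 := by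
    have h := he.sum_inner_products_le (F y) (s := Finset.univ)
    simp only [hva, neg_sq, mul_pow, ← Finset.mul_sum]
    simp only [Real.norm_eq_abs, sq_abs] at h
    linarith
  have hgrad (a : ι) : v y * fderiv ℝ u y (e a) = -(2 * u y * fderiv ℝ v y (e a)) := by
    have h := congrArg (fun T => T (e a)) hmax'.fderiv_eq_zero
    rw [fderiv_fun_mul (hv1.fun_mul hv1) hu1, fderiv_fun_mul hv1 hv1] at h
    simp only [add_apply, smul_apply, smul_eq_mul, zero_apply] at h
    refine mul_left_cancel₀ (hvy ▸ hv0.ne' : v y ≠ 0) ?_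
    linarith
  have hLφ := frameLaplacian_nonpos_of_isLocalMax e w ((hv.mul hv).mul hu) hmax'
  rw [frameLaplacian_mul e w (hv.mul hv) hu, frameLaplacian_mul e w hv hv] at hLφ
  have hcross : ∑ a, fderiv ℝ (fun z => v z * v z) y (e a) * fderiv ℝ u y (e a) =
      -(4 * u y * ∑ a, fderiv ℝ v y (e a) ^ 2) := by
    rw [Finset.mul_sum, ← Finset.sum_neg_distrib]
    refine Finset.sum_congr rfl fun a _ => ?_
    rw [fderiv_fun_mul hv1 hv1]
    simp only [add_apply, smul_apply, smul_eq_mul]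
    linear_combination 2 * fderiv ℝ v y (e a) * hgrad a
  rw [hcross, hLu, hLv] at hLφ
  simp only [← sq] at hLφ
  have hS := card_mul_norm_pow_four_le hF hH he hLF hperp
  rw [← hn] at hS
  have hin : ⟪F y, H y⟫_ℝ ≤ R * ‖H y‖ :=
    (real_inner_le_norm _ _).trans (by gcongr)
  rw [huy, hvy] at hLφ
  generalize ∑ a, fderiv ℝ v y (e a) ^ 2 = K at *
  generalize ∑ a, ‖fderiv ℝ H y (e a)‖ ^ 2 = S at *
  have hvR : R ^ 2 - ‖F y‖ ^ 2 ≤ R ^ 2 := by nlinarith [norm_nonneg (F y)]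
  have hfR : ‖F y‖ ^ 2 ≤ R ^ 2 := by linarith
  generalize ⟪F y, H y⟫_ℝ = s at *
  generalize ‖H y‖ = h at *
  generalize R ^ 2 - ‖F y‖ ^ 2 = x at *
  have h1 : n * (x * h) ^ 2 ≤ 3 * K + x * (2 * n * s + 2 * n) := by
    have hx : 0 < 2 * h ^ 2 := by positivity
    refine le_of_mul_le_mul_left ?_ hx
    nlinarith [mul_le_mul_of_nonneg_left hS (sq_nonneg x)]
  have h2 : x * (2 * n * s + 2 * n) ≤ n * (2 * R * (x * h) + 2 * R ^ 2) := by
    have h3 : x * s ≤ x * (R * h) := mul_le_mul_of_nonneg_left hin hv0.le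
    have h4 : x * s + x ≤ R * (x * h) + R ^ 2 := by linarith
    nlinarith [mul_le_mul_of_nonneg_left h4 (by positivity : 0 ≤ 2 * n)]
  -- Here `3K ≤ 12R² ≤ 12nR²`, using `n ≥ 1`; the other `2R²` comes from the constant term of
  -- `-vΔv`.
  have h5 : n * (x * h) ^ 2 ≤ n * (14 * R ^ 2 + 2 * R * (x * h)) := by
    nlinarith [mul_le_mul_of_nonneg_right hn1 (sq_nonneg R)]
  have h6 := le_of_mul_le_mul_left h5 (by linarith)
  -- With `t = xh` the inequality is `t² ≤ 14R² + 2Rt`, which fails for `t > 5R` because then `t(t -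
  -- 2R) > 15R²`.
  by_contra! h7
  nlinarith

end MaximumPrinciple

/-! ### Passage from charts to the manifold, and conclusion by properness. -/

section Immersions

variable {n : ℕ} {E : Type*} [NormedAddCommGroup E] [InnerProductSpace ℝ E]
  {M : Type*} [TopologicalSpace M] [ChartedSpace (EuclideanSpace ℝ (Fin n)) M]
  [IsManifold (𝓡 n) ∞ M] {f : M → E}

theorem IsSmoothImmersion.comp_chart_symm (hf : IsSmoothImmersion (n := n) f) (p : M)
    {y : EuclideanSpace ℝ (Fin n)} (hy : y ∈ (chartAt (EuclideanSpace ℝ (Fin n)) p).target) :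
    ContDiffAt ℝ ∞ (f ∘ (chartAt (EuclideanSpace ℝ (Fin n)) p).symm) y ∧
      Function.Injective
        (fderiv ℝ (f ∘ (chartAt (EuclideanSpace ℝ (Fin n)) p).symm) y) := by
  set c := chartAt (EuclideanSpace ℝ (Fin n)) p
  have hc : ContMDiffAt (𝓡 n) (𝓡 n) ∞ c.symm y :=
    contMDiffAt_symm_of_mem_maximalAtlas (IsManifold.chart_mem_maximalAtlas p) hy
  have hc1 : MDifferentiableAt (𝓡 n) (𝓡 n) c.symm y := hc.mdifferentiableAt (by simp)
  have : IsManifold (𝓡 n) 1 M := IsManifold.of_le (n := ∞) (by simp)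
  refine ⟨contMDiffAt_iff_contDiffAt.1 (hf.1.contMDiffAt.comp y hc), ?_⟩
  have hd : fderiv ℝ (f ∘ c.symm) y = (mfderiv (𝓡 n) 𝓘(ℝ, E) f (c.symm y)).comp
      (mfderiv (𝓡 n) (𝓡 n) c.symm y) := by
    rw [← mfderiv_eq_fderiv]
    exact mfderiv_comp y ((hf.1.contMDiffAt).mdifferentiableAt (by simp)) hc1
  rw [hd]
  exact (hf.2 _).comp ((mdifferentiable_chart (I := 𝓡 n) p).symm.mfderiv_injective hy)

theorem IsSmoothImmersion.eventually_comp_chart_symm (hf : IsSmoothImmersion (n := n) f) (p : M)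
    {y : EuclideanSpace ℝ (Fin n)} (hy : y ∈ (chartAt (EuclideanSpace ℝ (Fin n)) p).target) :
    ∀ᶠ z in 𝓝 y, ContDiffAt ℝ ∞ (f ∘ (chartAt (EuclideanSpace ℝ (Fin n)) p).symm) z ∧
      Function.Injective
        (fderiv ℝ (f ∘ (chartAt (EuclideanSpace ℝ (Fin n)) p).symm) z) :=
  ((chartAt (EuclideanSpace ℝ (Fin n)) p).open_target.eventually_mem hy).mono fun _ =>
    hf.comp_chart_symm p

/-- `meanCurvature` uses a different chart at every point. Differentiating it near `p` requires one
fixed chart, which chart independence permits. -/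
theorem IsSmoothImmersion.meanCurvature_eq [CompleteSpace E]
    (hf : IsSmoothImmersion (n := n) f) (p : M)
    {q : M} (hq : q ∈ (chartAt (EuclideanSpace ℝ (Fin n)) p).source) :
    meanCurvature (n := n) f q =
      coordMeanCurvature (f ∘ (chartAt (EuclideanSpace ℝ (Fin n)) p).symm)
        (chartAt (EuclideanSpace ℝ (Fin n)) p q) := by
  set c := chartAt (EuclideanSpace ℝ (Fin n)) p with hc
  set c' := chartAt (EuclideanSpace ℝ (Fin n)) q with hc'
  have hq' : c' q ∈ c'.target := mem_chart_target _ q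
  have hqq : c'.symm (c' q) = q := c'.left_inv (mem_chart_source _ q)
  have hτ : ContDiffAt ℝ ∞ (c ∘ c'.symm) (c' q) := by
    refine contMDiffAt_iff_contDiffAt.1 (ContMDiffAt.comp (I' := 𝓡 n) (c' q) ?_
      (contMDiffAt_symm_of_mem_maximalAtlas (IsManifold.chart_mem_maximalAtlas q) hq'))
    rw [hqq]
    exact contMDiffAt_of_mem_maximalAtlas (IsManifold.chart_mem_maximalAtlas p) hq
  have hτq : (c ∘ c'.symm) (c' q) = c q := congrArg c hqq
  have hG : f ∘ c'.symm =ᶠ[𝓝 (c' q)] (f ∘ c.symm) ∘ (c ∘ c'.symm) := by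
    have h := (c'.continuousAt_symm hq').eventually
      (c.open_source.eventually_mem (by rwa [hqq]))
    filter_upwards [h] with z hz
    simp [c.left_inv hz]
  have hF := (hf.comp_chart_symm p (c.map_source hq)).1
  rw [← hτq] at hF ⊢
  exact coordMeanCurvature_comp (by exact_mod_cast contDiffAt_infty.1 hF 2)
    (by exact_mod_cast contDiffAt_infty.1 hτ 2) hG (hf.comp_chart_symm q hq').2

theorem IsSmoothImmersion.meanCurvature_comp_chart_symm [CompleteSpace E]
    (hf : IsSmoothImmersion (n := n) f) (p : M)
    {y : EuclideanSpace ℝ (Fin n)} (hy : y ∈ (chartAt (EuclideanSpace ℝ (Fin n)) p).target) :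
    meanCurvature (n := n) f ∘ (chartAt (EuclideanSpace ℝ (Fin n)) p).symm =ᶠ[𝓝 y]
      coordMeanCurvature (f ∘ (chartAt (EuclideanSpace ℝ (Fin n)) p).symm) := by
  filter_upwards [(chartAt (EuclideanSpace ℝ (Fin n)) p).open_target.eventually_mem hy]
    with z hz
  rw [Function.comp_apply, hf.meanCurvature_eq p (OpenPartialHomeomorph.map_target _ hz),
    OpenPartialHomeomorph.right_inv _ hz]

theorem IsSmoothImmersion.continuous_meanCurvature [CompleteSpace E]
    (hf : IsSmoothImmersion (n := n) f) :
    Continuous (meanCurvature (n := n) f) := by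
  refine continuous_iff_continuousAt.2 fun p => ?_
  set c := chartAt (EuclideanSpace ℝ (Fin n)) p
  have hp : p ∈ c.source := mem_chart_source _ p
  have h := (contDiffAt_coordMeanCurvature
    (hf.eventually_comp_chart_symm p (c.map_source hp))).continuousAt
  refine (ContinuousAt.comp h (c.continuousAt hp)).congr ?_
  filter_upwards [c.open_source.eventually_mem hp] with q hq using (hf.meanCurvature_eq p hq).symm

/-- The value of `(R² - |f|²)|H|` at an interior local maximum is at most `5R`. -/
theorem IsBiharmonic.mul_norm_meanCurvature_le [CompleteSpace E] (hn : 0 < n)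
    (hf : IsSmoothImmersion (n := n) f) (hbi : IsBiharmonic (n := n) f) {R : ℝ} {p : M}
    (hp : ‖f p‖ < R) (hmax : IsLocalMax
      (fun q => (R ^ 2 - ‖f q‖ ^ 2) ^ 2 * ‖meanCurvature (n := n) f q‖ ^ 2) p) :
    (R ^ 2 - ‖f p‖ ^ 2) * ‖meanCurvature (n := n) f p‖ ≤ 5 * R := by
  have : Nonempty (Fin n) := ⟨⟨0, hn⟩⟩
  set c := chartAt (EuclideanSpace ℝ (Fin n)) p with hc
  have hy : c p ∈ c.target := mem_chart_target _ p
  have hpp : c.symm (c p) = p := c.left_inv (mem_chart_source _ p)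
  have hF := hf.eventually_comp_chart_symm p hy
  have hF2 : ContDiffAt ℝ 2 (f ∘ c.symm) (c p) := by
    exact_mod_cast contDiffAt_infty.1 hF.self_of_nhds.1 2
  have hHeq := hf.meanCurvature_comp_chart_symm p hy
  have hH2 : ContDiffAt ℝ 2 (meanCurvature (n := n) f ∘ c.symm) (c p) :=
    (contDiffAt_coordMeanCurvature hF).congr_of_eventuallyEq hHeq
  obtain ⟨e, he⟩ := exists_isOrthonormalFrame hF.self_of_nhds.2
  have hLF : frameLaplacian e (laplacianDrift (inducedMetric (f ∘ c.symm)) (c p))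
      (f ∘ c.symm) (c p) =
      (Fintype.card (Fin n) : ℝ) • (meanCurvature (n := n) f ∘ c.symm) (c p) := by
    rw [← he.coordLaplacian_eq hF2, coordLaplacian_self hF2 hF.self_of_nhds.2,
      hHeq.self_of_nhds, Fintype.card_fin]
  have hLH : frameLaplacian e (laplacianDrift (inducedMetric (f ∘ c.symm)) (c p))
      (meanCurvature (n := n) f ∘ c.symm) (c p) = 0 := by
    rw [← he.coordLaplacian_eq hH2]
    -- The Laplacian is evaluated only at `p`, in the preferred chart at `p`, so its own chart
    -- independence is not needed.
    exact hbi p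
  have hperp : ∀ᶠ z in 𝓝 (c p), ∀ v,
      ⟪(meanCurvature (n := n) f ∘ c.symm) z, fderiv ℝ (f ∘ c.symm) z v⟫_ℝ = 0 := by
    filter_upwards [hHeq] with z hz v
    rw [hz, inner_coordMeanCurvature_fderiv]
  have hmax' : IsLocalMax (fun z => (R ^ 2 - ‖(f ∘ c.symm) z‖ ^ 2) ^ 2 *
      ‖(meanCurvature (n := n) f ∘ c.symm) z‖ ^ 2) (c p) := by
    rw [← hpp] at hmax
    exact hmax.comp_tendsto (c.continuousAt_symm hy)
  simpa [hpp] using mul_norm_le_of_isLocalMax hF2 hH2 he hLF hLH hperp (by simpa [hpp]) hmax'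

/-- The bound at a maximum point `q` of `v²|H|²` passes to every `p`, since the bounded quantity is
the square root of the maximized one. -/
theorem IsBiharmonic.mul_norm_meanCurvature_le_of_isProperMap [CompleteSpace E] [ProperSpace E]
    (hn : 0 < n)
    (hf : IsSmoothImmersion (n := n) f) (hproper : IsProperMap f)
    (hbi : IsBiharmonic (n := n) f) {R : ℝ} {p : M} (hp : ‖f p‖ < R) :
    (R ^ 2 - ‖f p‖ ^ 2) * ‖meanCurvature (n := n) f p‖ ≤ 5 * R := by
  have hR : 0 < R := (norm_nonneg _).trans_lt hp
  have hv {q : M} (hq : ‖f q‖ ≤ R) : 0 ≤ R ^ 2 - ‖f q‖ ^ 2 := by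
    nlinarith [norm_nonneg (f q)]
  rcases eq_or_ne (meanCurvature (n := n) f p) 0 with h0 | h0
  · rw [h0, norm_zero, mul_zero]
    positivity
  have hK : IsCompact (f ⁻¹' Metric.closedBall 0 R) :=
    hproper.isCompact_preimage (isCompact_closedBall 0 R)
  have hcont : Continuous
      fun q => (R ^ 2 - ‖f q‖ ^ 2) ^ 2 * ‖meanCurvature (n := n) f q‖ ^ 2 := by
    have h1 := hproper.continuous
    have h2 := hf.continuous_meanCurvature
    fun_prop
  obtain ⟨q, hqK, hq⟩ := hK.exists_isMaxOn ⟨p, by simpa using hp.le⟩ hcont.continuousOn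
  have hpq := hq (show p ∈ f ⁻¹' Metric.closedBall 0 R by simpa using hp.le)
  simp only [Set.mem_ofPred_eq] at hpq
  have hqR : ‖f q‖ ≤ R := by simpa using hqK
  -- The cutoff vanishes where `‖f q‖ = R`, while the function is positive at `p`; so the maximum is
  -- interior, hence a local maximum on `M`.
  have hqlt : ‖f q‖ < R := by
    refine hqR.lt_of_ne fun h => ?_
    have h1 : 0 < R ^ 2 - ‖f p‖ ^ 2 := by nlinarith [norm_nonneg (f p)]
    have h2 : 0 < ‖meanCurvature (n := n) f p‖ := norm_pos_iff.2 h0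
    have h3 : 0 < (R ^ 2 - ‖f p‖ ^ 2) ^ 2 * ‖meanCurvature (n := n) f p‖ ^ 2 := by positivity
    rw [h, sub_self] at hpq
    linarith
  have hloc := hq.isLocalMax (mem_of_superset
    ((Metric.isOpen_ball.preimage hproper.continuous).mem_nhds (by simpa using hqlt))
    (Set.preimage_mono Metric.ball_subset_closedBall))
  refine le_trans ?_ (hbi.mul_norm_meanCurvature_le hn hf hqlt hloc)
  rw [← mul_pow, ← mul_pow] at hpq
  exact le_of_sq_le_sq hpq (mul_nonneg (hv hqR) (norm_nonneg _))

theorem IsBiharmonic.isMinimal [CompleteSpace E] [ProperSpace E]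
    (hf : IsSmoothImmersion (n := n) f) (hproper : IsProperMap f)
    (hbi : IsBiharmonic (n := n) f) : IsMinimal (n := n) f := by
  intro p
  rcases Nat.eq_zero_or_pos n with rfl | hn
  · simp [meanCurvature, coordMeanCurvature]
  by_contra h0
  have hh : 0 < ‖meanCurvature (n := n) f p‖ := norm_pos_iff.2 h0
  set h := ‖meanCurvature (n := n) f p‖ with hdef
  have hr := norm_nonneg (f p)
  -- An explicit `R` replaces the limit. With `r = ‖f p‖` and `s = 7/h`, the left side is `3r²h +
  -- 28r + 7s`, which exceeds `5R = 10r + 5s`; any constant above `5` in place of `7` would do.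
  have key := hbi.mul_norm_meanCurvature_le_of_isProperMap hn hf hproper (p := p)
    (R := 2 * ‖f p‖ + 7 / h) (by have : 0 < 7 / h := by positivity
                                 linarith)
  rw [← hdef] at key
  set r := ‖f p‖
  have h7 : 7 / h * h = 7 := div_mul_cancel₀ _ hh.ne'
  have hs : 0 < 7 / h := by positivity
  generalize 7 / h = s at *
  have h1 : ((2 * r + s) ^ 2 - r ^ 2) * h = 3 * (r * r * h) + 28 * r + 7 * s := by
    linear_combination (4 * r + s) * h7
  have h2 : 0 ≤ r * r * h := by positivity
  linarith

end Immersions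

end Submanifold

end

theorem mainTheorem2 {n N : ℕ} {M : Type*} [TopologicalSpace M] [T2Space M]
    [ChartedSpace (EuclideanSpace ℝ (Fin n)) M] [IsManifold (𝓡 n) ∞ M]
    (f : M → EuclideanSpace ℝ (Fin N))
    (hf : Submanifold.IsSmoothImmersion (n := n) f)
    (hproper : IsProperMap f)
    (hbi : Submanifold.IsBiharmonic (n := n) f) :
    Submanifold.IsMinimal (n := n) f :=
  hbi.isMinimal hf hproper
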